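/- Let $K$ be a field of characteristic zero, let $n\ge 1$, and let $d_0,\dots,d_n$ be positive integers. Let $\mathbb A=K[x_0,\dots,x_n]$, graded by $\deg x_i=d_i$, and let $\mathbb D=K\langle x_0,\dots,x_n,\partial_0,\dots,\partial_n\rangle$ ($\partial_i=\partial/\partial x_i$) be the Weyl algebra, graded by $\deg x_i=d_i$, $\deg\partial_i=-d_i$. Let $E=\sum_i d_ix_i\partial_i\in\mathbb D_0$ and fix $\lambda\in K$. A left $\mathbb D$-module $M$ is called $\lambda$-Euler if $M=\bigoplus_{k\in\mathbb Z}M_k$, where $M_k=\{m\in M: Em=(\lambda+k)m\}$; it is called torsion if every $m\in M$ satisfies $\mathbb A_km=0$ for all sufficiently large $k$. Let $\mathbb D\text{-Gr}^\lambda$ be the category of $\lambda$-Euler $\mathbb D$-modules (a full subcategory of all $\mathbb D$-modules), let $\mathbb D\text{-Tors}^\lambda$ be its Serre subcategory of torsion modules, and define the category of $\lambda$-twisted D-modules on the weighted projective stack $[X]=[(K^{n+1}\setminus 0)/\mathbb G_m]$ as the quotient category $$\mathcal D^\lambda_{[X]}\text{-Qcoh}=\mathbb D\text{-Gr}^\lambda/\mathbb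 D\text{-Tors}^\lambda .$$ The quotient functor $\pi:\mathbb D\text{-Gr}^\lambda\to\mathcal D^\lambda_{[X]}\text{-Qcoh}$ has a right adjoint $\omega$. Since $E$ is central in $\mathbb D_0$, the degree zero part $(D^\lambda_{[X]})_0=\mathbb D_0/\mathbb D_0(E-\lambda)$ of $D^\lambda_{[X]}=\mathbb D/\mathbb D(E-\lambda)$ is an algebra, and it acts on $M_0$ for every $\lambda$-Euler module $M$. Let $$\Gamma_\lambda:\mathcal D^\lambda_{[X]}\text{-Qcoh}\to (D^\lambda_{[X]})_0\text{-Mod},\qquad \Gamma_\lambda(\mathcal M)=\omega(\mathcal M)_0 .$$ Let $\mathcal A\subset K$ be the set of all $\mathbb Z_{\ge0}$-linear combinations of $d_0,\dots,d_n$, and suppose $\lambda\notin -\sum_i d_i-\mathcal A$, that is, $\lambda\neq-\sum_i d_i-a$ for all $a\in\mathcal A$. **Theorem.** The functor $\Gamma_\lambda$ is exact. Moreover, $\Gamma_\lambda$ induces an equivalence between the quotient category $\mathcal D^\lambda_{[X]}\text{-Qcoh}/\operatorname{Ker}\Gamma_\lambda$ (where $\operatorname{Ker}\Gamma_\lambda$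 is the Serre subcategory of all $\mathcal M$ with $\Gamma_\lambda(\mathcal M)=0$) and $(D^\lambda_{[X]})_0\text{-Mod}$: there is an equivalence $F$ from this quotient category to $(D^\lambda_{[X]})_0\text{-Mod}$ with $F\circ Q\cong\Gamma_\lambda$, where $Q$ is the quotient functor. -/

import Mathlib

open CategoryTheory CategoryTheory.Limits

universe u

noncomputable section

namespace WPS

/-! ### The Weyl algebra -/

section Weyl

variable (K : Type u) [Field K] (n : ℕ)

/-- The polynomial ring `𝔸 = K[x₀, …, xₙ]`. -/
abbrev Poly : Type u := MvPolynomial (Fin (n + 1)) K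

/-- The Weyl algebra `𝔻 = K⟨x₀, …, xₙ, ∂₀, …, ∂ₙ⟩`, as the algebra of `K`-linear operators on
`K[x₀, …, xₙ]` generated by the multiplications by the `xᵢ` and the `∂ᵢ = ∂/∂xᵢ`. -/
def weylSubalgebra : Subalgebra K (Module.End K (Poly K n)) :=
  Algebra.adjoin K
    (Set.range (fun i => LinearMap.mulLeft K (MvPolynomial.X i : Poly K n)) ∪
      Set.range (fun i => ((MvPolynomial.pderiv i : Derivation K (Poly K n) (Poly K n)) :
        Poly K n →ₗ[K] Poly K n)))

/-- The Weyl algebra as a type. -/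
def Weyl : Type u := ↥(weylSubalgebra K n)

instance : Ring (Weyl K n) := inferInstanceAs (Ring ↥(weylSubalgebra K n))

instance : Algebra K (Weyl K n) := inferInstanceAs (Algebra K ↥(weylSubalgebra K n))

variable {K n}

/-- The operator on polynomials given by an element of the Weyl algebra. -/
def Weyl.op : Weyl K n →ₐ[K] Module.End K (Poly K n) := (weylSubalgebra K n).val

lemma Weyl.op_injective : Function.Injective (Weyl.op (K := K) (n := n)) :=
  Subtype.val_injective

lemma Weyl.ext' {v w : Weyl K n} (h : ∀ f, Weyl.op v f = Weyl.op w f) : v = w :=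
  Weyl.op_injective (LinearMap.ext h)

/-- The generator `∂ᵢ` of the Weyl algebra. -/
def Weyl.del (i : Fin (n + 1)) : Weyl K n :=
  ⟨((MvPolynomial.pderiv i : Derivation K (Poly K n) (Poly K n)) : Poly K n →ₗ[K] Poly K n),
    Algebra.subset_adjoin (Or.inr ⟨i, rfl⟩)⟩

lemma mulLeft_mem (p : Poly K n) : LinearMap.mulLeft K p ∈ weylSubalgebra K n := by
  have h : LinearMap.mulLeft K p = Algebra.lmul K (Poly K n) p := rfl
  rw [h]
  induction p using MvPolynomial.induction_on with
  | C a =>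
    rw [← MvPolynomial.algebraMap_eq, AlgHom.commutes]
    exact Subalgebra.algebraMap_mem _ _
  | add p q hp hq => rw [map_add]; exact add_mem (hp rfl) (hq rfl)
  | mul_X p i hp =>
    rw [map_mul]
    exact mul_mem (hp rfl) (Algebra.subset_adjoin (Or.inl ⟨i, rfl⟩))

/-- The inclusion of the polynomial ring `𝔸` in the Weyl algebra `𝔻`. -/
def polyToWeyl : Poly K n →ₐ[K] Weyl K n :=
  (Algebra.lmul K (Poly K n)).codRestrict (weylSubalgebra K n) mulLeft_mem

/-- The generator `xᵢ` of the Weyl algebra. -/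
def Weyl.x (i : Fin (n + 1)) : Weyl K n := polyToWeyl (MvPolynomial.X i)

@[simp]
lemma op_polyToWeyl (p f : Poly K n) : Weyl.op (polyToWeyl p) f = p * f := rfl

@[simp]
lemma op_x (i : Fin (n + 1)) (f : Poly K n) :
    Weyl.op (Weyl.x i : Weyl K n) f = MvPolynomial.X i * f := rfl

@[simp]
lemma op_del (i : Fin (n + 1)) (f : Poly K n) :
    Weyl.op (Weyl.del i : Weyl K n) f = MvPolynomial.pderiv i f := rfl

lemma Weyl.induction {p : Weyl K n → Prop} (w : Weyl K n)
    (hx : ∀ i, p (Weyl.x i)) (hd : ∀ i, p (Weyl.del i))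
    (hc : ∀ c : K, p (algebraMap K _ c))
    (hadd : ∀ v w, p v → p w → p (v + w)) (hmul : ∀ v w, p v → p w → p (v * w)) : p w := by
  obtain ⟨w, hw⟩ := w
  refine Algebra.adjoin_induction (p := fun w hw => p ⟨w, hw⟩) ?_ ?_ ?_ ?_ hw
  · rintro _ (⟨i, rfl⟩ | ⟨i, rfl⟩)
    · exact hx i
    · exact hd i
  · exact hc
  · intro v w hv hw h1 h2; exact hadd _ _ h1 h2
  · intro v w hv hw h1 h2; exact hmul _ _ h1 h2

lemma del_mul_poly (i : Fin (n + 1)) (p : Poly K n) :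
    Weyl.del i * polyToWeyl p
      = polyToWeyl p * Weyl.del i + polyToWeyl (MvPolynomial.pderiv i p) := by
  apply Weyl.ext'
  intro f
  simp only [map_mul, map_add, Module.End.mul_apply, LinearMap.add_apply, op_polyToWeyl, op_del,
    Derivation.leibniz, smul_eq_mul]
  ring

/-! ### The grading and the Euler field -/

variable (d : Fin (n + 1) → ℕ+)

variable (K) in
/-- `𝔸ₖ`: the polynomials of degree `k` for the grading with `deg xᵢ = dᵢ`. -/
def polyDegree (k : ℤ) : Submodule K (Poly K n) :=
  MvPolynomial.weightedHomogeneousSubmodule K (fun i => ((d i : ℕ) : ℤ)) k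

variable (K) in
/-- `𝔻ₖ`: the elements of degree `k` of the Weyl algebra, for the grading induced by that of
`𝔸` (for which `deg xᵢ = dᵢ` and `deg ∂ᵢ = -dᵢ`). -/
def weylDegree (k : ℤ) : Submodule K (Weyl K n) where
  carrier := {w | ∀ j : ℤ, ∀ f ∈ polyDegree K d j, Weyl.op w f ∈ polyDegree K d (j + k)}
  zero_mem' j f _ := by simp
  add_mem' hv hw j f hf := by
    rw [map_add]; exact add_mem (hv j f hf) (hw j f hf)
  smul_mem' c w hw j f hf := by
    rw [map_smul]; exact Submodule.smul_mem _ c (hw j f hf)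

variable (K) in
/-- The subalgebra `𝔻₀` of the Weyl algebra. -/
def weylZero : Subalgebra K (Weyl K n) where
  carrier := weylDegree K d 0
  mul_mem' {v w} hv hw j f hf := by
    have h := hv _ _ (hw j f hf)
    simpa [map_mul] using h
  add_mem' hv hw := (weylDegree K d 0).add_mem hv hw
  algebraMap_mem' c j f hf := by
    rw [AlgHom.commutes, add_zero]
    exact Submodule.smul_mem _ c hf

lemma x_mem_weylDegree (i : Fin (n + 1)) : (Weyl.x i : Weyl K n) ∈ weylDegree K d ((d i : ℕ) : ℤ) := by
  intro j f hf
  rw [op_x, add_comm j]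
  exact (MvPolynomial.isWeightedHomogeneous_X K (fun i => ((d i : ℕ) : ℤ)) i).mul hf

lemma del_mem_weylDegree (i : Fin (n + 1)) :
    (Weyl.del i : Weyl K n) ∈ weylDegree K d (-((d i : ℕ) : ℤ)) := by
  intro j f hf
  rw [op_del]
  exact (MvPolynomial.IsWeightedHomogeneous.pderiv (w := fun i => ((d i : ℕ) : ℤ)) hf (by simp))

variable (K) in
/-- The Euler field `E = ∑ᵢ dᵢ xᵢ ∂ᵢ`. -/
def euler : Weyl K n := ∑ i, ((d i : ℕ) : K) • (Weyl.x i * Weyl.del i)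

lemma op_euler {j : ℤ} {f : Poly K n} (hf : f ∈ polyDegree K d j) :
    Weyl.op (euler K d) f = (j : K) • f := by
  have key : ∀ m : Fin (n + 1) →₀ ℕ, ∀ c : K, Weyl.op (euler K d) (MvPolynomial.monomial m c) =
      ((Finsupp.weight (fun i => ((d i : ℕ) : ℤ)) m : ℤ) : K) • MvPolynomial.monomial m c := by
    intro m c
    have h1 : ∀ i, (MvPolynomial.X i : Poly K n) *
        MvPolynomial.pderiv i (MvPolynomial.monomial m c) =
        (m i : K) • MvPolynomial.monomial m c := by
      intro i
      rw [MvPolynomial.X_mul_pderiv_monomial]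
      rw [← Nat.cast_smul_eq_nsmul K]
    simp only [euler, map_sum, map_smul, map_mul, LinearMap.sum_apply, LinearMap.smul_apply,
      Module.End.mul_apply, op_x, op_del, h1, smul_smul, ← Finset.sum_smul]
    congr 1
    rw [Finsupp.weight_apply, Finsupp.sum_fintype _ _ (by simp)]
    push_cast
    exact Finset.sum_congr rfl fun i _ => by simp [mul_comm]
  have hf' : MvPolynomial.IsWeightedHomogeneous (fun i => ((d i : ℕ) : ℤ)) f j := hf
  conv_lhs => rw [f.as_sum]
  conv_rhs => rw [f.as_sum]
  rw [map_sum, Finset.smul_sum]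
  refine Finset.sum_congr rfl fun m hm => ?_
  rw [key, hf' (MvPolynomial.mem_support_iff.1 hm)]

lemma euler_mem_weylZero : euler K d ∈ weylZero K d := by
  intro j f hf
  rw [op_euler d hf, add_zero]
  exact Submodule.smul_mem _ _ hf

lemma monomial_mem_polyDegree (m : Fin (n + 1) →₀ ℕ) (c : K) :
    MvPolynomial.monomial m c ∈ polyDegree K d (Finsupp.weight (fun i => ((d i : ℕ) : ℤ)) m) :=
  MvPolynomial.isWeightedHomogeneous_monomial _ _ _ rfl

lemma euler_commute {w : Weyl K n} {k : ℤ} (hw : w ∈ weylDegree K d k) :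
    euler K d * w = w * euler K d + (k : K) • w := by
  apply Weyl.ext'
  intro f
  induction f using MvPolynomial.induction_on' with
  | add p q hp hq => rw [map_add, map_add, hp, hq]
  | monomial m c =>
    have h := monomial_mem_polyDegree (K := K) d m c
    simp only [map_mul, map_add, map_smul, LinearMap.add_apply, Module.End.mul_apply,
      LinearMap.smul_apply]
    rw [op_euler d h, op_euler d (hw _ _ h), map_smul, ← add_smul]
    push_cast
    rfl

lemma euler_commute_zero {w : Weyl K n} (hw : w ∈ weylZero K d) :
    euler K d * w = w * euler K d := by
  simpa using euler_commute d (k := 0) hw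

variable (K) in
/-- The Euler field as an element of `𝔻₀`. -/
def eulerZero : weylZero K d := ⟨euler K d, euler_mem_weylZero d⟩

/-- The left ideal `𝔻₀ (E - λ)` of `𝔻₀`. -/
def eulerIdeal (lam : K) : Ideal (weylZero K d) :=
  Ideal.span {eulerZero K d - algebraMap K _ lam}

instance (lam : K) : (eulerIdeal d lam).IsTwoSided := by
  constructor
  intro a b ha
  obtain ⟨c, rfl⟩ := Submodule.mem_span_singleton.1 ha
  refine Submodule.mem_span_singleton.2 ⟨c * b, ?_⟩
  have h : (eulerZero K d - algebraMap K _ lam) * b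
      = b * (eulerZero K d - algebraMap K _ lam) := by
    rw [sub_mul, mul_sub, Algebra.commutes]
    congr 1
    exact Subtype.ext (euler_commute_zero d b.2)
  rw [smul_eq_mul, smul_eq_mul, mul_assoc, ← h, mul_assoc]

/-- The algebra `𝔻₀ / 𝔻₀ (E - λ)`, the degree zero part of `𝔻 / 𝔻 (E - λ)`. -/
abbrev TwistedOps (lam : K) : Type u := weylZero K d ⧸ eulerIdeal d lam

/-! ### Weight spaces, Euler modules and torsion modules -/

section Modules

variable {M : Type*} [AddCommGroup M] [Module (Weyl K n) M]

variable (M) in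
/-- The `μ`-eigenspace `M^μ` of the Euler field on a `𝔻`-module `M`, as a `𝔻₀`-module. -/
def weightSpace (μ : K) : Submodule (weylZero K d) M where
  carrier := {m | euler K d • m = algebraMap K (Weyl K n) μ • m}
  zero_mem' := by simp
  add_mem' {a b} ha hb := by
    simp only [Set.mem_ofPred_eq] at *
    rw [smul_add, smul_add, ha, hb]
  smul_mem' w m hm := by
    simp only [Set.mem_ofPred_eq] at *
    rw [Subalgebra.smul_def, ← mul_smul, euler_commute_zero d w.2, mul_smul, hm, ← mul_smul,
      ← mul_smul, Algebra.commutes]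

variable {d} in
lemma mem_weightSpace {μ : K} {m : M} :
    m ∈ weightSpace d M μ ↔ euler K d • m = algebraMap K (Weyl K n) μ • m := Iff.rfl

variable (M) in
/-- A `𝔻`-module is `λ`-Euler if it is the sum of the eigenspaces `M^(λ + k)`, `k ∈ ℤ`, of the
Euler field. It is then graded by `M_k = M^(λ + k)`. -/
def IsEulerModule (lam : K) : Prop := ⨆ k : ℤ, weightSpace d M (lam + k) = ⊤

variable (K) in
/-- An element `m` of a `𝔻`-module is torsion if `𝔸ₖ m = 0` for all large `k`. -/
def IsTorsionElt (m : M) : Prop :=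
  ∃ N : ℤ, ∀ k > N, ∀ a ∈ polyDegree K d k, (polyToWeyl a : Weyl K n) • m = 0


lemma x_pow_eq (i : Fin (n + 1)) (k : ℕ) :
    (Weyl.x i : Weyl K n) ^ k = polyToWeyl (MvPolynomial.X i ^ k) := by
  rw [map_pow]; rfl

lemma isTorsionElt_iff (m : M) :
    IsTorsionElt K d m ↔ ∀ i, ∃ k : ℕ, (Weyl.x i : Weyl K n) ^ k • m = 0 := by
  constructor
  · rintro ⟨N, hN⟩ i
    refine ⟨N.toNat + 1, ?_⟩
    rw [x_pow_eq]
    refine hN ((N.toNat + 1) • ((d i : ℕ) : ℤ)) ?_ _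
      ((MvPolynomial.isWeightedHomogeneous_X K (fun i => ((d i : ℕ) : ℤ)) i).pow _)
    have h1 : (1 : ℤ) ≤ ((d i : ℕ) : ℤ) := by exact_mod_cast (d i).pos
    have h2 := Int.self_le_toNat N
    rw [nsmul_eq_mul]
    push_cast
    nlinarith
  · intro h
    choose k hk using h
    refine ⟨∑ i, (k i : ℤ) * ((d i : ℕ) : ℤ), fun l hl a ha => ?_⟩
    have ha' : MvPolynomial.IsWeightedHomogeneous (fun i => ((d i : ℕ) : ℤ)) a l := ha
    rw [a.as_sum, map_sum, Finset.sum_smul]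
    refine Finset.sum_eq_zero fun α hα => ?_
    have hw := ha' (MvPolynomial.mem_support_iff.1 hα)
    rw [Finsupp.weight_apply, Finsupp.sum_fintype _ _ (by simp)] at hw
    obtain ⟨i, hi⟩ : ∃ i, k i ≤ α i := by
      by_contra hcon
      push Not at hcon
      have : ∑ i, (α i : ℕ) • ((d i : ℕ) : ℤ) ≤ ∑ i, (k i : ℤ) * ((d i : ℕ) : ℤ) := by
        refine Finset.sum_le_sum fun i _ => ?_
        rw [nsmul_eq_mul]
        have := hcon i
        gcongr
      omega
    have hsplit : MvPolynomial.monomial α (MvPolynomial.coeff α a) =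
        MvPolynomial.monomial (α - Finsupp.single i (k i)) (MvPolynomial.coeff α a) *
          MvPolynomial.X i ^ k i := by
      rw [MvPolynomial.X_pow_eq_monomial, MvPolynomial.monomial_mul, mul_one,
        tsub_add_cancel_of_le (Finsupp.single_le_iff.2 hi)]
    rw [hsplit, map_mul, mul_smul, ← x_pow_eq, hk, smul_zero]

lemma x_pow_smul_eq_zero_of_le {m : M} {i : Fin (n + 1)} {k l : ℕ} (hkl : k ≤ l)
    (h : (Weyl.x i : Weyl K n) ^ k • m = 0) : (Weyl.x i : Weyl K n) ^ l • m = 0 := by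
  obtain ⟨c, rfl⟩ := Nat.exists_eq_add_of_le' hkl
  rw [pow_add, mul_smul, h, smul_zero]

lemma IsTorsionElt.smul {m : M} (h : IsTorsionElt K d m) (w : Weyl K n) :
    IsTorsionElt K d (w • m) := by
  induction w using Weyl.induction generalizing m with
  | hx j =>
    rw [isTorsionElt_iff] at h ⊢
    intro i
    obtain ⟨k, hk⟩ := h i
    refine ⟨k, ?_⟩
    have : (Weyl.x i : Weyl K n) ^ k * Weyl.x j = Weyl.x j * Weyl.x i ^ k := by
      rw [x_pow_eq, Weyl.x, ← map_mul, ← map_mul, mul_comm]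
    rw [← mul_smul, this, mul_smul, hk, smul_zero]
  | hd j =>
    rw [isTorsionElt_iff] at h ⊢
    intro i
    obtain ⟨k, hk⟩ := h i
    refine ⟨k + 1, ?_⟩
    have h1 := del_mul_poly (K := K) j (MvPolynomial.X i ^ (k + 1))
    rw [← x_pow_eq, Derivation.leibniz_pow, Nat.add_sub_cancel, smul_eq_mul, mul_comm (_ ^ k),
      ← smul_mul_assoc, map_mul, ← x_pow_eq] at h1
    rw [← mul_smul, eq_sub_iff_add_eq.2 h1.symm, sub_smul, mul_smul, mul_smul,
      x_pow_smul_eq_zero_of_le k.le_succ hk, hk, smul_zero, smul_zero, sub_zero]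
  | hc c =>
    rw [isTorsionElt_iff] at h ⊢
    intro i
    obtain ⟨k, hk⟩ := h i
    refine ⟨k, ?_⟩
    rw [← mul_smul, ← Algebra.commutes, mul_smul, hk, smul_zero]
  | hadd v w hv hw =>
    have h1 := hv h
    have h2 := hw h
    rw [isTorsionElt_iff] at h1 h2 ⊢
    intro i
    obtain ⟨k, hk⟩ := h1 i
    obtain ⟨l, hl⟩ := h2 i
    refine ⟨max k l, ?_⟩
    rw [add_smul, smul_add, x_pow_smul_eq_zero_of_le (le_max_left _ _) hk,
      x_pow_smul_eq_zero_of_le (le_max_right _ _) hl, add_zero]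
  | hmul v w hv hw =>
    rw [mul_smul]
    exact hv (hw h)

lemma IsTorsionElt.add {a b : M} (ha : IsTorsionElt K d a) (hb : IsTorsionElt K d b) :
    IsTorsionElt K d (a + b) := by
  rw [isTorsionElt_iff] at *
  intro i
  obtain ⟨k, hk⟩ := ha i
  obtain ⟨l, hl⟩ := hb i
  refine ⟨max k l, ?_⟩
  rw [smul_add, x_pow_smul_eq_zero_of_le (le_max_left _ _) hk,
    x_pow_smul_eq_zero_of_le (le_max_right _ _) hl, add_zero]

variable (K M) in
/-- The torsion submodule `τ(M)` of a `𝔻`-module. -/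
def torsionSubmodule : Submodule (Weyl K n) M where
  carrier := {m | IsTorsionElt K d m}
  zero_mem' := ⟨0, fun _ _ _ _ => smul_zero _⟩
  add_mem' := IsTorsionElt.add d
  smul_mem' w _ h := IsTorsionElt.smul d h w

variable {d} in
lemma mem_torsionSubmodule {m : M} : m ∈ torsionSubmodule K d M ↔ IsTorsionElt K d m := Iff.rfl

section Maps

variable {N : Type*} [AddCommGroup N] [Module (Weyl K n) N]

variable {d} in
lemma IsTorsionElt.map {m : M} (h : IsTorsionElt K d m) (f : M →ₗ[Weyl K n] N) :
    IsTorsionElt K d (f m) := by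
  obtain ⟨N, hN⟩ := h
  exact ⟨N, fun k hk a ha => by rw [← map_smul, hN k hk a ha, map_zero]⟩

variable {d} in
lemma IsTorsionElt.of_map {m : M} {f : M →ₗ[Weyl K n] N} (h : IsTorsionElt K d (f m))
    (hf : ∀ x, f x = 0 → IsTorsionElt K d x) : IsTorsionElt K d m := by
  rw [isTorsionElt_iff] at h ⊢
  intro i
  obtain ⟨k, hk⟩ := h i
  rw [← map_smul] at hk
  obtain ⟨l, hl⟩ := (isTorsionElt_iff d _).1 (hf _ hk) i
  exact ⟨l + k, by rw [pow_add, mul_smul, hl]⟩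

end Maps

/-! #### Sums of eigenvectors -/

/-- The element `∏_{k ∈ S} (E - λ - k)` of the Weyl algebra. -/
def eulerPoly (lam : K) (S : Finset ℤ) : Weyl K n :=
  Polynomial.aeval (euler K d) (∏ k ∈ S, (Polynomial.X - Polynomial.C (lam + k)))

lemma eulerPoly_smul_eq_zero_of_subset {lam : K} {S T : Finset ℤ} (h : S ⊆ T) {m : M}
    (hm : eulerPoly d lam S • m = 0) : eulerPoly d lam T • m = 0 := by
  obtain ⟨q, hq⟩ := Finset.prod_dvd_prod_of_subset S T
    (fun k : ℤ => (Polynomial.X - Polynomial.C (lam + k) : Polynomial K)) h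
  rw [eulerPoly, hq, mul_comm, map_mul, mul_smul]
  exact (congrArg _ hm).trans (smul_zero _)

lemma aeval_euler_smul (p : Polynomial K) {μ : K} {m : M} (hm : m ∈ weightSpace d M μ) :
    Polynomial.aeval (euler K d) p • m = algebraMap K (Weyl K n) (p.eval μ) • m := by
  induction p using Polynomial.induction_on' with
  | add p q hp hq => rw [map_add, add_smul, hp, hq, Polynomial.eval_add, map_add, add_smul]
  | monomial k c =>
    rw [Polynomial.aeval_monomial, Polynomial.eval_monomial, map_mul, mul_smul, mul_smul]
    congr 1
    induction k with
    | zero => simp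
    | succ k ih =>
      rw [pow_succ, mul_smul, mem_weightSpace.1 hm, ← mul_smul, ← Algebra.commutes, mul_smul, ih,
        ← mul_smul, ← map_mul, pow_succ, mul_comm]

lemma exists_eulerPoly_of_mem_iSup {lam : K} {m : M}
    (hm : m ∈ ⨆ k : ℤ, weightSpace d M (lam + k)) : ∃ S, eulerPoly d lam S • m = 0 := by
  induction hm using Submodule.iSup_induction' with
  | mem k m hm =>
    refine ⟨{k}, ?_⟩
    rw [eulerPoly, aeval_euler_smul d _ hm]
    simp
  | zero => exact ⟨∅, smul_zero _⟩
  | add a b _ _ ha hb =>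
    obtain ⟨S, hS⟩ := ha
    obtain ⟨T, hT⟩ := hb
    refine ⟨S ∪ T, ?_⟩
    rw [smul_add, eulerPoly_smul_eq_zero_of_subset d Finset.subset_union_left hS,
      eulerPoly_smul_eq_zero_of_subset d Finset.subset_union_right hT, add_zero]

lemma algebraMap_smul_mem {lam : K} {m : M} (c : K)
    (hm : m ∈ ⨆ k : ℤ, weightSpace d M (lam + k)) :
    algebraMap K (Weyl K n) c • m ∈ ⨆ k : ℤ, weightSpace d M (lam + k) :=
  Submodule.smul_mem _ (algebraMap K (weylZero K d) c) hm

lemma mem_iSup_of_eulerPoly [CharZero K] {lam : K} (S : Finset ℤ) {m : M}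
    (hm : eulerPoly d lam S • m = 0) : m ∈ ⨆ k : ℤ, weightSpace d M (lam + k) := by
  induction S using Finset.induction_on generalizing m with
  | empty =>
    have : m = 0 := by simpa [eulerPoly] using hm
    rw [this]; exact zero_mem _
  | insert k S hk ih =>
    set c : K := (∏ j ∈ S, (Polynomial.X - Polynomial.C (lam + j))).eval (lam + k) with hc
    have hc0 : c ≠ 0 := by
      rw [hc, Polynomial.eval_prod, Finset.prod_ne_zero_iff]
      intro j hj
      rw [Polynomial.eval_sub, Polynomial.eval_X, Polynomial.eval_C, add_sub_add_left_eq_sub,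
        sub_ne_zero]
      intro h
      rw [Int.cast_inj] at h
      exact hk (h ▸ hj)
    have hu : eulerPoly d lam S • m ∈ weightSpace d M (lam + k) := by
      rw [eulerPoly, Finset.prod_insert hk, map_mul, mul_smul] at hm
      rw [mem_weightSpace, ← sub_eq_zero, ← sub_smul]
      simpa [eulerPoly] using hm
    have hv : algebraMap K (Weyl K n) c⁻¹ • (eulerPoly d lam S • m) ∈
        weightSpace d M (lam + k) :=
      Submodule.smul_mem _ (algebraMap K (weylZero K d) c⁻¹) hu
    have h1 : m - algebraMap K (Weyl K n) c⁻¹ • (eulerPoly d lam S • m) ∈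
        ⨆ k : ℤ, weightSpace d M (lam + k) := by
      apply ih
      have hE : eulerPoly d lam S • (algebraMap K (Weyl K n) c⁻¹ • (eulerPoly d lam S • m)) = _ :=
        aeval_euler_smul d _ hv
      rw [smul_sub, hE, ← mul_smul, ← map_mul]
      rw [← hc, mul_inv_cancel₀ hc0, map_one, one_smul, sub_self]
    have h2 := Submodule.mem_iSup_of_mem (p := fun k : ℤ => weightSpace d M (lam + k)) k hv
    simpa using add_mem h1 h2

lemma isEulerModule_iff [CharZero K] {lam : K} :
    IsEulerModule d M lam ↔ ∀ m : M, ∃ S, eulerPoly d lam S • m = 0 := by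
  refine ⟨fun h m => exists_eulerPoly_of_mem_iSup d (h ▸ Submodule.mem_top), fun h => ?_⟩
  refine Submodule.eq_top_iff'.2 fun m => ?_
  obtain ⟨S, hS⟩ := h m
  exact mem_iSup_of_eulerPoly d S hS

lemma weylDegree_smul_mem {w : Weyl K n} {k : ℤ} (hw : w ∈ weylDegree K d k) {lam : K} {m : M}
    (hm : m ∈ ⨆ k : ℤ, weightSpace d M (lam + k)) : w • m ∈ ⨆ k : ℤ, weightSpace d M (lam + k) := by
  induction hm using Submodule.iSup_induction' with
  | mem j m hm =>
    refine Submodule.mem_iSup_of_mem (p := fun k : ℤ => weightSpace d M (lam + k)) (j + k) ?_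
    rw [mem_weightSpace] at hm ⊢
    rw [← mul_smul, euler_commute d hw, add_smul, mul_smul, hm, ← mul_smul, ← Algebra.commutes,
      ← add_smul, Int.cast_add, Algebra.smul_def, ← mul_smul]
    simp only [map_add, add_mul, add_assoc]
  | zero => rw [smul_zero]; exact zero_mem _
  | add a b _ _ ha hb => rw [smul_add]; exact add_mem ha hb

variable (M) in
/-- The largest `λ`-Euler submodule of a `𝔻`-module. -/
def eulerPart (lam : K) : Submodule (Weyl K n) M where
  carrier := (⨆ k : ℤ, weightSpace d M (lam + k) : Submodule (weylZero K d) M)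
  zero_mem' := Submodule.zero_mem _
  add_mem' := Submodule.add_mem _
  smul_mem' w m hm := by
    change w • m ∈ ⨆ k : ℤ, weightSpace d M (lam + k)
    induction w using Weyl.induction generalizing m with
    | hx i => exact weylDegree_smul_mem d (x_mem_weylDegree d i) hm
    | hd i => exact weylDegree_smul_mem d (del_mem_weylDegree d i) hm
    | hc c => exact algebraMap_smul_mem d c hm
    | hadd v w hv hw => rw [add_smul]; exact add_mem (hv m hm) (hw m hm)
    | hmul v w hv hw => rw [mul_smul]; exact hv _ (hw m hm)

lemma mem_eulerPart_iff [CharZero K] {lam : K} {m : M} :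
    m ∈ eulerPart d M lam ↔ ∃ S, eulerPoly d lam S • m = 0 :=
  ⟨exists_eulerPoly_of_mem_iSup d, fun ⟨S, hS⟩ => mem_iSup_of_eulerPoly d S hS⟩

/-! #### Closed modules -/

variable (K) in
/-- An element of a module is torsion modulo a submodule. -/
def TorsionMod (P : Submodule (Weyl K n) M) (m : M) : Prop :=
  ∀ i, ∃ k : ℕ, (Weyl.x i : Weyl K n) ^ k • m ∈ P

lemma torsionMod_iff (P : Submodule (Weyl K n) M) (m : M) :
    TorsionMod K P m ↔ IsTorsionElt K d (P.mkQ m) := by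
  rw [isTorsionElt_iff]
  refine forall_congr' fun i => exists_congr fun k => ?_
  rw [← map_smul, Submodule.mkQ_apply, Submodule.Quotient.mk_eq_zero]

lemma TorsionMod.trans {P P' : Submodule (Weyl K n) M} {m : M} (h : TorsionMod K P m)
    (h' : ∀ p ∈ P, TorsionMod K P' p) : TorsionMod K P' m := by
  intro i
  obtain ⟨k, hk⟩ := h i
  obtain ⟨l, hl⟩ := h' _ hk i
  exact ⟨l + k, by rwa [pow_add, mul_smul]⟩

lemma isTorsionElt_iff_bot (m : M) :
    IsTorsionElt K d m ↔ TorsionMod K (⊥ : Submodule (Weyl K n) M) m := by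
  simp [isTorsionElt_iff, TorsionMod]

/-- The submodule of elements that are torsion modulo a submodule. -/
def torsionClosure (P : Submodule (Weyl K n) M) : Submodule (Weyl K n) M :=
  (torsionSubmodule K d (M ⧸ P)).comap P.mkQ

lemma mem_torsionClosure {P : Submodule (Weyl K n) M} {m : M} :
    m ∈ torsionClosure d P ↔ TorsionMod K P m := (torsionMod_iff d P m).symm

lemma eq_of_torsionMod {N : Type*} [AddCommGroup N] [Module (Weyl K n) N]
    (hN : ∀ x : N, IsTorsionElt K d x → x = 0) {P : Submodule (Weyl K n) M}
    (hP : ∀ m, TorsionMod K P m) {f g : M →ₗ[Weyl K n] N} (hfg : ∀ p ∈ P, f p = g p) : f = g := by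
  ext m
  rw [← sub_eq_zero]
  refine hN _ ((isTorsionElt_iff d _).2 fun i => ?_)
  obtain ⟨k, hk⟩ := hP m i
  exact ⟨k, by rw [smul_sub, ← map_smul, ← map_smul, hfg _ hk, sub_self]⟩

end Modules

/-- Every `𝔻`-module maps, with torsion kernel and cokernel, to a torsion-free module that is
closed with respect to such maps. -/
lemma exists_closed (M : Type u) [AddCommGroup M] [Module (Weyl K n) M] :
    ∃ (N : Type u) (_ : AddCommGroup N) (_ : Module (Weyl K n) N) (u : M →ₗ[Weyl K n] N),
      (∀ m, u m = 0 → IsTorsionElt K d m) ∧ (∀ y, TorsionMod K (LinearMap.range u) y) ∧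
      ∀ (X Y : Type u) [AddCommGroup X] [AddCommGroup Y] [Module (Weyl K n) X]
        [Module (Weyl K n) Y] (g : X →ₗ[Weyl K n] Y), (∀ x, g x = 0 → IsTorsionElt K d x) →
        (∀ y, TorsionMod K (LinearMap.range g) y) →
        ∀ h : X →ₗ[Weyl K n] N, ∃! h' : Y →ₗ[Weyl K n] N, h' ∘ₗ g = h := by
  let E : ModuleCat.{u} (Weyl K n) :=
    Injective.under (ModuleCat.of _ (M ⧸ torsionSubmodule K d M))
  let j : (M ⧸ torsionSubmodule K d M) →ₗ[Weyl K n] E :=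
    (Injective.ι (ModuleCat.of _ (M ⧸ torsionSubmodule K d M))).hom
  have hj : Function.Injective j := (ModuleCat.mono_iff_injective _).1
    (inferInstanceAs (Mono (Injective.ι (ModuleCat.of _ (M ⧸ torsionSubmodule K d M)))))
  have : Injective (ModuleCat.of (Weyl K n) E) :=
    inferInstanceAs (Injective (Injective.under (ModuleCat.of (Weyl K n) _)))
  have hE : Module.Injective (Weyl K n) E :=
    Module.injective_module_of_injective_object (Weyl K n) E
  let q : E →ₗ[Weyl K n] E ⧸ torsionSubmodule K d E := (torsionSubmodule K d E).mkQ
  let v : M →ₗ[Weyl K n] E ⧸ torsionSubmodule K d E :=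
    q ∘ₗ j ∘ₗ (torsionSubmodule K d M).mkQ
  have hF : ∀ x : E ⧸ torsionSubmodule K d E, IsTorsionElt K d x → x = 0 := by
    intro x hx
    obtain ⟨e, rfl⟩ := (torsionSubmodule K d E).mkQ_surjective x
    have h : IsTorsionElt K d e := IsTorsionElt.of_map hx fun y hy => by
      rwa [Submodule.mkQ_apply, Submodule.Quotient.mk_eq_zero] at hy
    rw [Submodule.mkQ_apply, Submodule.Quotient.mk_eq_zero]
    exact h
  have hv : ∀ m, v m = 0 → IsTorsionElt K d m := by
    intro m hm
    have h1 : IsTorsionElt K d (j ((torsionSubmodule K d M).mkQ m)) := by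
      change q (j _) = 0 at hm
      rwa [Submodule.mkQ_apply, Submodule.Quotient.mk_eq_zero] at hm
    refine IsTorsionElt.of_map (f := (torsionSubmodule K d M).mkQ)
      (IsTorsionElt.of_map h1 fun x hx => ?_) fun x hx => ?_
    · rw [hj (hx.trans (map_zero j).symm)]
      exact ⟨0, fun _ _ _ _ => smul_zero _⟩
    · rwa [Submodule.mkQ_apply, Submodule.Quotient.mk_eq_zero] at hx
  let P := torsionClosure d (LinearMap.range v)
  have hvP : ∀ m, v m ∈ P := fun m => (mem_torsionClosure d).2 fun i =>
    ⟨0, by rw [pow_zero, one_smul]; exact ⟨m, rfl⟩⟩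
  have hPF : ∀ x : P, IsTorsionElt K d x → x = 0 := fun x hx =>
    Subtype.ext (hF _ (hx.map P.subtype))
  refine ⟨P, inferInstance, inferInstance, v.codRestrict P hvP,
    fun m hm => hv m (congrArg Subtype.val hm), ?_, ?_⟩
  · intro y i
    obtain ⟨k, m, hm⟩ := (mem_torsionClosure d).1 y.2 i
    exact ⟨k, m, Subtype.ext hm⟩
  · intro X Y _ _ _ _ g hg1 hg2 h
    have huniq : ∀ h₁ h₂ : Y →ₗ[Weyl K n] P, h₁ ∘ₗ g = h → h₂ ∘ₗ g = h → h₁ = h₂ := by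
      intro h₁ h₂ e₁ e₂
      refine eq_of_torsionMod d hPF hg2 ?_
      rintro _ ⟨x, rfl⟩
      exact LinearMap.congr_fun (e₁.trans e₂.symm) x
    suffices hex : ∃ h' : Y →ₗ[Weyl K n] P, h' ∘ₗ g = h by
      obtain ⟨h', hh'⟩ := hex
      exact ⟨h', hh', fun h₂ e₂ => huniq _ _ e₂ hh'⟩
    have hker : ∀ x, g x = 0 → h x = 0 := fun x hx => hPF _ ((hg1 x hx).map h)
    -- the submodule of `X` of elements that `h` maps to the image of `M`
    let X₁ : Submodule (Weyl K n) X := (LinearMap.range v).comap (P.subtype ∘ₗ h)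
    have hX₁ : ∀ x, TorsionMod K X₁ x := by
      intro x i
      obtain ⟨k, hk⟩ := (mem_torsionClosure d).1 (h x).2 i
      exact ⟨k, by simpa [X₁] using hk⟩
    -- the image of `M` in `E / τ(E)` lifts to `E`
    let R : Submodule (Weyl K n) E := LinearMap.range j
    have hqR : Function.Injective (q ∘ₗ R.subtype) := by
      rw [← LinearMap.ker_eq_bot, LinearMap.ker_eq_bot']
      rintro ⟨_, y, rfl⟩ hy
      obtain ⟨m, rfl⟩ := (torsionSubmodule K d M).mkQ_surjective y
      have hm : IsTorsionElt K d m := hv m hy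
      have : (torsionSubmodule K d M).mkQ m = 0 := by
        rw [Submodule.mkQ_apply, Submodule.Quotient.mk_eq_zero]; exact hm
      exact Subtype.ext ((congrArg j this).trans (map_zero j))
    let e := LinearEquiv.ofInjective (q ∘ₗ R.subtype) hqR
    have hXR : ∀ x : X₁, (h x : E ⧸ torsionSubmodule K d E) ∈ LinearMap.range (q ∘ₗ R.subtype) := by
      rintro ⟨x, m, hm⟩
      exact ⟨⟨j ((torsionSubmodule K d M).mkQ m), _, rfl⟩, hm⟩
    let l : X₁ →ₗ[Weyl K n] E := R.subtype ∘ₗ e.symm.toLinearMap ∘ₗ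
      (P.subtype ∘ₗ h ∘ₗ X₁.subtype).codRestrict _ hXR
    have hl : ∀ x, q (l x) = h x := by
      intro x
      exact congrArg Subtype.val (e.apply_symm_apply ⟨_, hXR x⟩)
    -- descend `l` to the image of `X₁` in `Y` and extend
    let g₁ : X₁ →ₗ[Weyl K n] Y := g ∘ₗ X₁.subtype
    have hl0 : LinearMap.ker g₁ ≤ LinearMap.ker l := by
      intro x hx
      have h0 : h x = 0 := hker _ hx
      have : (P.subtype ∘ₗ h ∘ₗ X₁.subtype).codRestrict _ hXR x = 0 :=
        Subtype.ext (congrArg (fun p : P => (p : E ⧸ torsionSubmodule K d E)) h0)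
      rw [LinearMap.mem_ker]
      simp only [l, LinearMap.comp_apply, this, map_zero]
    obtain ⟨H, hH⟩ := hE.out ((LinearMap.ker g₁).liftQ g₁ le_rfl)
      (LinearMap.ker_eq_bot.1 (Submodule.ker_liftQ_eq_bot _ _ _ le_rfl))
      ((LinearMap.ker g₁).liftQ l hl0)
    have hHl : ∀ x : X₁, H (g x) = l x := fun x => hH (Submodule.Quotient.mk x)
    have hHP : ∀ y, (q ∘ₗ H) y ∈ P := by
      intro y
      rw [mem_torsionClosure]
      refine TorsionMod.trans (P := P) (fun i => ?_) fun p hp => (mem_torsionClosure d).1 hp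
      obtain ⟨k, x, hx⟩ := hg2 y i
      obtain ⟨k', hk'⟩ := hX₁ x i
      refine ⟨k' + k, ?_⟩
      have h3 := hHl ⟨_, hk'⟩
      rw [← map_smul, pow_add, mul_smul, ← hx, ← map_smul, LinearMap.comp_apply, h3, hl]
      exact Subtype.prop _
    refine ⟨(q ∘ₗ H).codRestrict P hHP, ?_⟩
    refine eq_of_torsionMod d hPF hX₁ fun x hx => Subtype.ext ?_
    exact (congrArg q (hHl ⟨x, hx⟩)).trans (hl ⟨x, hx⟩)

end Weyl

/-! ### The category of twisted D-modules -/

section Cat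

variable {K : Type u} [Field K] {n : ℕ} (d : Fin (n + 1) → ℕ+) (lam : K)

/-- The property of a `𝔻`-module of being `λ`-Euler. -/
def isEuler : ObjectProperty (ModuleCat.{u} (Weyl K n)) := fun M => IsEulerModule d M lam

/-- The category of `λ`-Euler `𝔻`-modules. As `𝔻`-linear maps commute with the Euler field, they
automatically preserve the canonical gradings. -/
abbrev EulerMod := (isEuler d lam).FullSubcategory

variable (K) in
/-- The property of a `𝔻`-module of being torsion as an `𝔸`-module. -/
def isTorsion : ObjectProperty (ModuleCat.{u} (Weyl K n)) := fun M => ∀ m : M, IsTorsionElt K d m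

instance : (isTorsion K d).IsSerreClass where
  exists_zero := ⟨ModuleCat.of _ PUnit, ModuleCat.isZero_of_subsingleton _,
    fun _ => ⟨0, fun _ _ _ _ => rfl⟩⟩
  prop_of_mono {M N} f hf hN m := by
    rw [ModuleCat.mono_iff_injective] at hf
    refine IsTorsionElt.of_map (f := f.hom) (hN _) fun x hx => ?_
    rw [hf (hx.trans (map_zero f.hom).symm)]
    exact ⟨0, fun _ _ _ _ => smul_zero _⟩
  prop_of_epi {M N} f hf hM m := by
    rw [ModuleCat.epi_iff_surjective] at hf
    obtain ⟨x, rfl⟩ := hf m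
    exact (hM x).map f.hom
  prop_X₂_of_shortExact {S} hS h₁ h₃ m := by
    refine IsTorsionElt.of_map (f := S.g.hom) (h₃ _) fun x hx => ?_
    obtain ⟨y, rfl⟩ := (ShortComplex.moduleCat_exact_iff S).1 hS.exact x hx
    exact (h₁ y).map S.f.hom

variable [CharZero K]

instance : (isEuler d lam).ContainsZero where
  exists_zero := ⟨ModuleCat.of _ PUnit, ModuleCat.isZero_of_subsingleton _,
    (isEulerModule_iff d).2 fun _ => ⟨∅, rfl⟩⟩

instance : (isEuler d lam).IsClosedUnderSubobjects where
  prop_of_mono {M N} f hf hN := by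
    rw [ModuleCat.mono_iff_injective] at hf
    refine (isEulerModule_iff d).2 fun m => ?_
    obtain ⟨S, hS⟩ := (isEulerModule_iff d).1 hN (f.hom m)
    exact ⟨S, hf (by simpa using hS)⟩

instance : (isEuler d lam).IsClosedUnderQuotients where
  prop_of_epi {M N} f hf hM := by
    rw [ModuleCat.epi_iff_surjective] at hf
    refine (isEulerModule_iff d).2 fun m => ?_
    obtain ⟨x, rfl⟩ := hf m
    obtain ⟨S, hS⟩ := (isEulerModule_iff d).1 hM x
    exact ⟨S, by
      have := congrArg f.hom hS
      simpa using this⟩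

instance : (isEuler d lam).IsClosedUnderFiniteProducts where
  isClosedUnderLimitsOfShape J _ := ⟨by
    rintro X ⟨p⟩
    have := Fintype.ofFinite J
    refine (isEulerModule_iff d).2 fun m => ?_
    have h := fun j : J => (isEulerModule_iff d).1 (p.prop_diag_obj ⟨j⟩) ((p.π.app ⟨j⟩).hom m)
    choose S hS using h
    classical
    refine ⟨Finset.univ.biUnion S, ?_⟩
    refine Concrete.isLimit_ext p.diag p.isLimit _ _ ?_
    rintro ⟨j⟩
    have h1 := eulerPoly_smul_eq_zero_of_subset d
      (Finset.subset_biUnion_of_mem S (Finset.mem_univ j)) (hS j)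
    rw [← map_smul] at h1
    exact h1.trans (map_zero (p.π.app ⟨j⟩).hom).symm⟩

instance : PreservesFiniteLimits (isEuler d lam).ι := by
  rw [((Functor.preservesFiniteLimits_tfae (isEuler d lam).ι).out 3 2 :)]
  intro _ _ f
  exact (isEuler d lam).preservesKernels_ι f

instance : PreservesFiniteColimits (isEuler d lam).ι := by
  rw [((Functor.preservesFiniteColimits_tfae (isEuler d lam).ι).out 3 2 :)]
  intro _ _ f
  exact (isEuler d lam).preservesCokernels_ι f

/-- The property of a `λ`-Euler `𝔻`-module of being torsion. -/
abbrev isTorsionEuler : ObjectProperty (EulerMod d lam) :=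
  (isTorsion K d).inverseImage (isEuler d lam).ι

/-- The category of `λ`-twisted D-modules on `[ℙ(V)]`: the quotient of the category of `λ`-Euler
`𝔻`-modules by the Serre subcategory of torsion modules. -/
abbrev QCoh := (isTorsionEuler d lam).isoModSerre.Localization

/-- The quotient functor `π` from `λ`-Euler `𝔻`-modules to `λ`-twisted D-modules. -/
abbrev quot : EulerMod d lam ⥤ QCoh d lam := (isTorsionEuler d lam).isoModSerre.Q

instance : Abelian (QCoh d lam) :=
  ObjectProperty.SerreClassLocalization.abelian (quot d lam) (isTorsionEuler d lam)

end Cat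

/-! ### The section functor -/

section SectionFunctor

variable {K : Type u} [Field K] [CharZero K] {n : ℕ} (d : Fin (n + 1) → ℕ+) (lam : K)

lemma isoModSerre_iff {X Y : EulerMod d lam} (f : X ⟶ Y) :
    (isTorsionEuler d lam).isoModSerre f ↔
      (∀ x, f.hom.hom x = 0 → IsTorsionElt K d x) ∧
        ∀ y, TorsionMod K (LinearMap.range f.hom.hom) y := by
  have h1 : isTorsion K d ((isEuler d lam).ι.obj (kernel f)) ↔
      ∀ x, f.hom.hom x = 0 → IsTorsionElt K d x := by
    rw [(isTorsion K d).prop_iff_of_iso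
      (PreservesKernel.iso (isEuler d lam).ι f ≪≫ ModuleCat.kernelIsoKer _)]
    constructor
    · intro h x hx
      exact (h ⟨x, hx⟩).map (LinearMap.ker f.hom.hom).subtype
    · rintro h ⟨x, hx⟩
      exact IsTorsionElt.of_map (f := (LinearMap.ker f.hom.hom).subtype) (h x hx) fun y hy => by
        rw [Subtype.ext (a1 := y) (a2 := 0) hy]
        exact ⟨0, fun _ _ _ _ => smul_zero _⟩
  have h2 : isTorsion K d ((isEuler d lam).ι.obj (cokernel f)) ↔
      ∀ y, TorsionMod K (LinearMap.range f.hom.hom) y := by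
    rw [(isTorsion K d).prop_iff_of_iso
      (PreservesCokernel.iso (isEuler d lam).ι f ≪≫ ModuleCat.cokernelIsoRangeQuotient _)]
    constructor
    · intro h y
      exact (torsionMod_iff d _ _).2 (h _)
    · intro h z
      obtain ⟨y, rfl⟩ := (LinearMap.range f.hom.hom).mkQ_surjective z
      exact (torsionMod_iff d _ _).1 (h y)
  exact and_congr h1 h2

/-- Every `λ`-Euler module has a reflection in the category of modules that are local for the
maps with torsion kernel and cokernel. -/
lemma exists_local (M : EulerMod d lam) :
    ∃ (N : EulerMod d lam) (u : M ⟶ N), (isTorsionEuler d lam).isoModSerre u ∧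
      (isTorsionEuler d lam).isoModSerre.isLocal N := by
  obtain ⟨N, _, _, u, hu1, hu2, hN⟩ := exists_closed (K := K) (n := n) d M.obj
  let N' : EulerMod d lam := ⟨ModuleCat.of (Weyl K n) (eulerPart d N lam), by
    refine (isEulerModule_iff d).2 fun m => ?_
    obtain ⟨S, hS⟩ := (mem_eulerPart_iff d).1 m.2
    exact ⟨S, Subtype.ext hS⟩⟩
  have key : ∀ (X : EulerMod d lam) (f : X.obj →ₗ[Weyl K n] N) (x : X.obj),
      f x ∈ eulerPart d N lam := by
    intro X f x
    obtain ⟨S, hS⟩ := (isEulerModule_iff d).1 X.property x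
    exact (mem_eulerPart_iff d).2 ⟨S, by rw [← map_smul, hS, map_zero]⟩
  let u' : M ⟶ N' := ObjectProperty.homMk (ModuleCat.ofHom (u.codRestrict _ (key M u)))
  refine ⟨N', u', (isoModSerre_iff d lam u').2 ⟨?_, ?_⟩, ?_⟩
  · intro x hx
    exact hu1 x (congrArg Subtype.val hx)
  · intro y i
    obtain ⟨k, m, hm⟩ := hu2 y.1 i
    exact ⟨k, m, Subtype.ext hm⟩
  · intro X Y g hg
    rw [isoModSerre_iff] at hg
    have hg' := hN X.obj Y.obj g.hom.hom hg.1 hg.2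
    constructor
    · intro a b hab
      obtain ⟨_, _, h⟩ := hg' ((eulerPart d N lam).subtype ∘ₗ (g ≫ a).hom.hom)
      have ha := h ((eulerPart d N lam).subtype ∘ₗ a.hom.hom) rfl
      have hb := h ((eulerPart d N lam).subtype ∘ₗ b.hom.hom) (by
        have hab' : g ≫ a = g ≫ b := hab
        rw [hab']; rfl)
      ext y
      exact LinearMap.congr_fun (ha.trans hb.symm) y
    · intro a
      obtain ⟨h', hh', -⟩ := hg' ((eulerPart d N lam).subtype ∘ₗ a.hom.hom)
      refine ⟨ObjectProperty.homMk (ModuleCat.ofHom (h'.codRestrict _ (key Y h'))), ?_⟩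
      ext x
      exact LinearMap.congr_fun hh' x

/-- The quotient functor has a right adjoint. -/
instance : (quot d lam).IsLeftAdjoint := by
  have : ∀ A, HasTerminal (CostructuredArrow (quot d lam) A) := by
    intro A
    let W := (isTorsionEuler d lam).isoModSerre
    have := Localization.essSurj (quot d lam) W
    obtain ⟨N, u, hu, hN⟩ := exists_local d lam ((quot d lam).objPreimage A)
    have hiso : IsIso ((quot d lam).map u) := Localization.inverts (quot d lam) W u hu
    let e : (quot d lam).obj N ≅ A :=
      (asIso ((quot d lam).map u)).symm ≪≫ (quot d lam).objObjPreimageIso A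
    have hex : ∀ B : CostructuredArrow (quot d lam) A,
        ∃ f : B.left ⟶ N, (quot d lam).map f = B.hom ≫ e.inv := by
      intro B
      obtain ⟨φ, hφ⟩ := Localization.exists_rightFraction (quot d lam) W (B.hom ≫ e.inv)
      obtain ⟨g, hg⟩ := (hN φ.s φ.hs).2 φ.f
      have hs : IsIso ((quot d lam).map φ.s) := Localization.inverts (quot d lam) W _ φ.hs
      refine ⟨g, ?_⟩
      rw [hφ, ← cancel_epi ((quot d lam).map φ.s),
        MorphismProperty.RightFraction.map_s_comp_map, ← hg, Functor.map_comp]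
    have huniq : ∀ (B : EulerMod d lam) (f g : B ⟶ N),
        (quot d lam).map f = (quot d lam).map g → f = g := by
      intro B f g h
      obtain ⟨Z, s, hs, hsf⟩ := (MorphismProperty.map_eq_iff_precomp (quot d lam) W f g).1 h
      exact (hN s hs).1 hsf
    let T : CostructuredArrow (quot d lam) A := CostructuredArrow.mk e.hom
    have h1 : ∀ B, Nonempty (B ⟶ T) := fun B => by
      obtain ⟨f, hf⟩ := hex B
      exact ⟨CostructuredArrow.homMk f (by simp [T, hf])⟩
    have h2 : ∀ B, Subsingleton (B ⟶ T) := fun B => ⟨fun f g => by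
      apply CostructuredArrow.hom_ext
      apply huniq
      have hf := CostructuredArrow.w f
      have hg := CostructuredArrow.w g
      exact (cancel_mono e.hom).1 (hf.trans hg.symm)⟩
    exact hasTerminal_of_unique T
  exact isLeftAdjoint_of_costructuredArrowTerminals _

/-- The section functor `ω`, right adjoint to the quotient functor `π`. -/
def sectionFunctor : QCoh d lam ⥤ EulerMod d lam := (quot d lam).rightAdjoint

/-- The adjunction between the quotient functor and the section functor. -/
def quotAdjunction : quot d lam ⊣ sectionFunctor d lam := Adjunction.ofIsLeftAdjoint _

end SectionFunctor

/-! ### The global sections functor -/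

section GlobalSections

variable {K : Type u} [Field K] {n : ℕ} (d : Fin (n + 1) → ℕ+) (lam : K)

section

variable {M : Type*} [AddCommGroup M] [Module (Weyl K n) M]

/-- The action of `𝔻₀ / 𝔻₀ (E - λ)` on the `λ`-eigenspace of `E` induced by the action
of `𝔻₀`. -/
def twistedAction : TwistedOps d lam →+* AddMonoid.End (weightSpace d M lam) :=
  Ideal.Quotient.lift (eulerIdeal d lam)
    (Module.toAddMonoidEnd (weylZero K d) (weightSpace d M lam)) (by
      intro a ha
      obtain ⟨c, rfl⟩ := Submodule.mem_span_singleton.1 ha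
      refine AddMonoidHom.ext fun m => Subtype.ext ?_
      change ((c : Weyl K n) * (euler K d - algebraMap K (Weyl K n) lam)) • (m : M) = 0
      rw [mul_smul, sub_smul, mem_weightSpace.1 m.2, sub_self, smul_zero])

instance : Module (TwistedOps d lam) (weightSpace d M lam) :=
  Module.compHom _ (twistedAction (M := M) d lam)

lemma twistedOps_mk_smul (w : weylZero K d) (m : weightSpace d M lam) :
    (Ideal.Quotient.mk (eulerIdeal d lam) w) • m = w • m := rfl

end

/-- The functor `M ↦ M₀ = M^λ` from `𝔻`-modules to `𝔻₀ / 𝔻₀ (E - λ)`-modules. -/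
def degreeZero : ModuleCat.{u} (Weyl K n) ⥤ ModuleCat.{u} (TwistedOps d lam) where
  obj M := ModuleCat.of _ (weightSpace d M lam)
  map {M N} f := ModuleCat.ofHom
    { toFun m := ⟨f.hom m, by
        rw [mem_weightSpace, ← map_smul, mem_weightSpace.1 m.2, map_smul]⟩
      map_add' a b := Subtype.ext (map_add f.hom _ _)
      map_smul' w m := by
        obtain ⟨w, rfl⟩ := Ideal.Quotient.mk_surjective w
        exact Subtype.ext (map_smul f.hom w.1 m.1) }

variable [CharZero K]

/-- The global sections functor `Γ_λ`, `𝓜 ↦ ω(𝓜)₀`. -/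
def globalSections : QCoh d lam ⥤ ModuleCat.{u} (TwistedOps d lam) :=
  sectionFunctor d lam ⋙ (isEuler d lam).ι ⋙ degreeZero d lam

end GlobalSections

end WPS

end

/-!
Write `G` for the degree zero part `M ↦ M₀` on `λ`-Euler modules, so that `Γ_λ = ω ⋙ G`.

A torsion element of a `𝔻`-module, moved by the `xᵢ` as long as the result is nonzero, ends in an
element killed by all `xᵢ`, on which `E = ∑ᵢ dᵢ (∂ᵢ xᵢ - 1)` acts by `-∑ᵢ dᵢ`. Since `xᵢ` raises the
eigenvalue of `E` by `dᵢ`, the eigenvalues of `E` on torsion elements lie in `-∑ᵢ dᵢ - 𝒜`. For `λ`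
outside this set `G` kills all torsion modules, hence `π ⋙ Γ_λ ≅ G`, and `Γ_λ` inherits from `G`
exactness and the property of being a localization.

`G` clearly preserves monomorphisms, and it has a right adjoint, the Euler part of
`N ↦ Hom_{𝔻₀}(𝔻, N)`; hence `G` is exact. A `𝔻₀`-linear map `𝔻 → N` of weight `λ` kills every `𝔻ₖ`
with `k ≠ 0`, so evaluation at `1` identifies the weight `λ` part of `Hom_{𝔻₀}(𝔻, N)` with `N`. The
right adjoint is therefore fully faithful, which makes `G` a localization.
-/

noncomputable section

namespace WPS

section Localization

variable {C D B : Type*} [Category* C] [Category* D] [Category* B] {L : C ⥤ D} {S : D ⥤ C}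

lemma isIso_counit_of_isLocalization (W : MorphismProperty C) [L.IsLocalization W] (adj : L ⊣ S) :
    IsIso adj.counit := by
  have := Localization.full_whiskeringLeft L W D
  have := Localization.faithful_whiskeringLeft L W D
  -- Precomposition with `L` is fully faithful and right adjoint to precomposition with `S`; the
  -- counit of that adjunction at `𝟭 D` is the counit of `adj`.
  have h : IsIso ((adj.whiskerLeft D).counit.app (𝟭 D)) := inferInstance
  have (Y : D) : IsIso (adj.counit.app Y) := by
    have hY : IsIso (((adj.whiskerLeft D).counit.app (𝟭 D)).app Y) := inferInstance
    simpa using hY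
  exact NatIso.isIso_of_isIso_app _

variable {G : C ⥤ B} (W : MorphismProperty C) [L.IsLocalization W]

lemma nonempty_comp_section_comp_iso (adj : L ⊣ S) (hG : W.IsInvertedBy G) :
    Nonempty (L ⋙ S ⋙ G ≅ G) := by
  have := isIso_counit_of_isLocalization W adj
  let e := Localization.fac G hG L
  exact ⟨L.isoWhiskerLeft (S.isoWhiskerLeft e.symm ≪≫ (Functor.associator _ _ _).symm ≪≫
    Functor.isoWhiskerRight (asIso adj.counit) _ ≪≫ Functor.leftUnitor _) ≪≫ e⟩

lemma isLocalization_section_comp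
    [G.IsLocalization ((MorphismProperty.isomorphisms B).inverseImage G)] (adj : L ⊣ S)
    (hG : W.IsInvertedBy G) :
    (S ⋙ G).IsLocalization ((MorphismProperty.isomorphisms B).inverseImage (S ⋙ G)) := by
  have := isIso_counit_of_isLocalization W adj
  obtain ⟨e⟩ := nonempty_comp_section_comp_iso W adj hG
  let W' := (MorphismProperty.isomorphisms B).inverseImage G
  have : (L ⋙ S ⋙ G).IsLocalization W' := Functor.IsLocalization.of_iso W' e.symm
  refine Functor.IsLocalization.of_comp L _ W _ W' hG (le_antisymm (fun X Y f hf => ?_) ?_)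
  · have hSf : W' (S.map f) := hf
    exact ((W'.map L).arrow_mk_iso_iff
      ((Arrow.isoMk (asIso (adj.counit.app X)) (asIso (adj.counit.app Y))))).1
      (W'.map_mem_map L _ hSf)
  · rw [MorphismProperty.map_le_iff]
    exact fun X Y f hf => (NatIso.isIso_map_iff e f).2 hf

end Localization

section SerreQuotient

variable {C D B : Type*} [Category* C] [Category* D] [Category* B] [Abelian C] [Abelian D]
  [Abelian B] {L : C ⥤ D} [L.Additive] {S : D ⥤ C} (P : ObjectProperty C) [P.IsSerreClass]
  [L.IsLocalization P.isoModSerre] {G : C ⥤ B}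

lemma preservesFiniteLimits_section_comp [PreservesFiniteLimits G] (adj : L ⊣ S)
    (hG : P.isoModSerre.IsInvertedBy G) : PreservesFiniteLimits (S ⋙ G) := by
  obtain ⟨e⟩ := nonempty_comp_section_comp_iso _ adj hG
  exact (ObjectProperty.SerreClassLocalization.preservesFiniteLimits_comp_iff L P _).1
    (preservesFiniteLimits_of_natIso e.symm)

lemma preservesFiniteColimits_section_comp [PreservesFiniteColimits G] (adj : L ⊣ S)
    (hG : P.isoModSerre.IsInvertedBy G) : PreservesFiniteColimits (S ⋙ G) := by
  obtain ⟨e⟩ := nonempty_comp_section_comp_iso _ adj hG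
  exact (ObjectProperty.SerreClassLocalization.preservesFiniteColimits_comp_iff L P _).1
    (preservesFiniteColimits_of_natIso e.symm)

end SerreQuotient

section WeightSpaces

variable {K : Type u} [Field K] {n : ℕ} {d : Fin (n + 1) → ℕ+} {M : Type*} [AddCommGroup M]
  [Module (Weyl K n) M]

lemma smul_mem_weightSpace {w : Weyl K n} {k : ℤ} (hw : w ∈ weylDegree K d k) {μ : K} {m : M}
    (hm : m ∈ weightSpace d M μ) : w • m ∈ weightSpace d M (μ + k) := by
  rw [mem_weightSpace] at hm ⊢
  calc euler K d • w • m = w • euler K d • m + ((k : K) • w) • m := by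
        rw [← mul_smul, euler_commute d hw, add_smul, mul_smul]
    _ = algebraMap K (Weyl K n) μ • w • m + algebraMap K (Weyl K n) k • w • m := by
        rw [hm, ← mul_smul, ← Algebra.commutes, mul_smul, Algebra.smul_def, mul_smul]
    _ = algebraMap K (Weyl K n) (μ + k) • w • m := by rw [map_add, add_smul]

variable (d M)

lemma iSupIndep_weightSpace : iSupIndep fun μ : K => weightSpace d M μ := by
  let _ : Module K M := Module.compHom M (algebraMap K (Weyl K n))
  have : SMulCommClass (Weyl K n) K M :=
    ⟨fun w c m => by
      change w • algebraMap K (Weyl K n) c • m = algebraMap K (Weyl K n) c • w • m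
      rw [← mul_smul, ← Algebra.commutes, mul_smul]⟩
  have h := Module.End.eigenspaces_iSupIndep (Module.toModuleEnd K M (euler K d))
  rw [iSupIndep_iff_finsetSum_eq_zero_imp_eq_zero] at h ⊢
  exact fun s v hv => h s v fun μ hμ => Module.End.mem_eigenspace_iff.2 (hv μ hμ)

variable {d M}

lemma eq_zero_of_mem_weightSpace_of_ne {μ ν : K} (hμν : μ ≠ ν) {m : M}
    (hμ : m ∈ weightSpace d M μ) (hν : m ∈ weightSpace d M ν) : m = 0 :=
  Submodule.disjoint_def.1 ((iSupIndep_weightSpace d M).pairwiseDisjoint hμν) m hμ hν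

end WeightSpaces

section Torsion

variable (K : Type u) [Field K] {n : ℕ} (d : Fin (n + 1) → ℕ+)

/-- The set `-∑ᵢ dᵢ - 𝒜` of the eigenvalues that the Euler field can have on a torsion element;
`𝒜` is the additive monoid generated by the `dᵢ`. -/
def torsionWeights : Set K :=
  {μ | ∃ a ∈ AddSubmonoid.closure (Set.range fun i => ((d i : ℕ) : K)),
    μ = -(∑ i, ((d i : ℕ) : K)) - a}

variable {K}

lemma neg_sum_mem_torsionWeights : -∑ i, ((d i : ℕ) : K) ∈ torsionWeights K d :=
  ⟨0, zero_mem _, (sub_zero _).symm⟩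

variable {d}

lemma mem_torsionWeights_of_add_mem {μ : K} (i : Fin (n + 1))
    (h : μ + (d i : ℕ) ∈ torsionWeights K d) : μ ∈ torsionWeights K d := by
  obtain ⟨a, ha, h⟩ := h
  exact ⟨a + (d i : ℕ), add_mem ha (AddSubmonoid.subset_closure ⟨i, rfl⟩), by linear_combination h⟩

lemma x_mul_del (i : Fin (n + 1)) :
    (Weyl.x i * Weyl.del i : Weyl K n) = Weyl.del i * Weyl.x i - 1 := by
  have h := del_mul_poly (K := K) i (MvPolynomial.X i)
  rw [MvPolynomial.pderiv_X_self, map_one] at h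
  exact eq_sub_of_add_eq h.symm

variable {M : Type*} [AddCommGroup M] [Module (Weyl K n) M]

lemma mem_weightSpace_of_x_smul_eq_zero {m : M} (h : ∀ i, (Weyl.x i : Weyl K n) • m = 0) :
    m ∈ weightSpace d M (-∑ i, ((d i : ℕ) : K)) := by
  have hxdel (i : Fin (n + 1)) : (Weyl.x i * Weyl.del i : Weyl K n) • m = -m := by
    rw [x_mul_del, sub_smul, mul_smul, h, smul_zero, one_smul, zero_sub]
  rw [mem_weightSpace, euler, Finset.sum_smul, map_neg, map_sum, neg_smul, Finset.sum_smul,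
    ← Finset.sum_neg_distrib]
  exact Finset.sum_congr rfl fun i _ => by rw [Algebra.smul_def, mul_smul, hxdel, smul_neg]

lemma IsTorsionElt.mem_torsionWeights {μ : K} {m : M} (ht : IsTorsionElt K d m)
    (hm : m ∈ weightSpace d M μ) (hm0 : m ≠ 0) : μ ∈ torsionWeights K d := by
  obtain ⟨N, hN⟩ := ht
  obtain ⟨k, hk⟩ : ∃ k : ℕ, N < k := ⟨N.toNat + 1, by omega⟩
  replace hN (l : ℤ) (hl : k ≤ l) := hN l (hk.trans_le hl)
  clear hk
  induction k generalizing m μ with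
  | zero =>
    refine absurd ?_ hm0
    simpa using hN 0 le_rfl 1 (MvPolynomial.isWeightedHomogeneous_one _ _)
  | succ k ih =>
    by_cases hx : ∀ i, (Weyl.x i : Weyl K n) • m = 0
    · by_contra hμ
      refine hm0 (eq_zero_of_mem_weightSpace_of_ne ?_ hm (mem_weightSpace_of_x_smul_eq_zero hx))
      rintro rfl
      exact hμ (neg_sum_mem_torsionWeights d)
    · push Not at hx
      obtain ⟨i, hi⟩ := hx
      refine mem_torsionWeights_of_add_mem i (ih ?_ hi fun l hl a ha => ?_)
      · simpa using smul_mem_weightSpace (x_mem_weylDegree d i) hm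
      · have hdi := (d i).pos
        rw [Weyl.x, ← mul_smul, ← map_mul]
        exact hN (l + (d i : ℕ)) (by push_cast; omega) _
          (ha.mul (MvPolynomial.isWeightedHomogeneous_X K _ i))

end Torsion

section Grading

variable {K : Type u} [Field K] {n : ℕ} (d : Fin (n + 1) → ℕ+)

instance : SetLike.GradedMonoid (weylDegree (n := n) K d) where
  one_mem := (weylZero K d).one_mem
  mul_mem k l v w hv hw j f hf := by
    rw [add_comm k, ← add_assoc, map_mul]
    exact hv _ _ (hw j f hf)

lemma iSup_weylDegree : ⨆ k, weylDegree K d k = (⊤ : Submodule K (Weyl K n)) := by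
  refine Submodule.eq_top_iff'.2 fun w => ?_
  induction w using Weyl.induction with
  | hx i => exact Submodule.mem_iSup_of_mem _ (x_mem_weylDegree d i)
  | hd i => exact Submodule.mem_iSup_of_mem _ (del_mem_weylDegree d i)
  | hc c => exact Submodule.mem_iSup_of_mem 0 ((weylZero K d).algebraMap_mem c)
  | hadd v w hv hw => exact add_mem hv hw
  | hmul v w hv hw =>
    induction hv using Submodule.iSup_induction' with
    | zero => rw [zero_mul]; exact zero_mem _
    | add v v' _ _ hv hv' => rw [add_mul]; exact add_mem hv hv'
    | mem k v hv =>
      induction hw using Submodule.iSup_induction' with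
      | zero => rw [mul_zero]; exact zero_mem _
      | add w w' _ _ hw hw' => rw [mul_add]; exact add_mem hw hw'
      | mem l w hw => exact Submodule.mem_iSup_of_mem (k + l) (SetLike.mul_mem_graded hv hw)

variable [CharZero K]

lemma iSupIndep_weylDegree : iSupIndep (weylDegree (n := n) K d) := by
  let adE : Module.End K (Weyl K n) :=
    LinearMap.mulLeft K (euler K d) - LinearMap.mulRight K (euler K d)
  have hle (k : ℤ) : weylDegree K d k ≤ adE.eigenspace (k : K) := fun w hw => by
    rw [Module.End.mem_eigenspace_iff, LinearMap.sub_apply, LinearMap.mulLeft_apply,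
      LinearMap.mulRight_apply, euler_commute d hw, add_sub_cancel_left]
  exact (adE.eigenspaces_iSupIndep.comp Int.cast_injective).mono hle

instance : GradedAlgebra (weylDegree (n := n) K d) where
  toDecomposition := (DirectSum.isInternal_submodule_of_iSupIndep_of_iSup_eq_top
    (iSupIndep_weylDegree d) (iSup_weylDegree d)).chooseDecomposition

end Grading

section DegreeZeroProjection

variable (K : Type u) [Field K] [CharZero K] {n : ℕ} (d : Fin (n + 1) → ℕ+)

/-- The projection of `𝔻 = ⨁ₖ 𝔻ₖ` to its degree zero part, as a map of left `𝔻₀`-modules. -/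
def weylZeroProj : Weyl K n →ₗ[weylZero K d] weylZero K d where
  toFun v := DirectSum.decompose (weylDegree K d) v 0
  map_add' v w := by rw [DirectSum.decompose_add]; rfl
  map_smul' a v := Subtype.ext (DirectSum.coe_decompose_mul_of_left_mem_zero _ a.2)

variable {K}

lemma weylZeroProj_coe (a : weylZero K d) : weylZeroProj K d a = a :=
  Subtype.ext (DirectSum.decompose_of_mem_same (weylDegree K d) a.2)

lemma weylZeroProj_eq_zero {k : ℤ} (hk : k ≠ 0) {v : Weyl K n} (hv : v ∈ weylDegree K d k) :
    weylZeroProj K d v = 0 :=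
  Subtype.ext (DirectSum.decompose_of_mem_ne (weylDegree K d) hv hk)

lemma weylZeroProj_mul_coe (v : Weyl K n) (a : weylZero K d) :
    weylZeroProj K d (v * a) = weylZeroProj K d v * a :=
  Subtype.ext (DirectSum.coe_decompose_mul_of_right_mem_zero (weylDegree K d) a.2)

end DegreeZeroProjection

section DegreeZero

variable {K : Type u} [Field K] {n : ℕ} {d : Fin (n + 1) → ℕ+} {lam : K} {M : Type*}
  [AddCommGroup M] [Module (Weyl K n) M]

lemma IsEulerModule.isCompl_weightSpace (h : IsEulerModule d M lam) (μ : K) :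
    IsCompl (weightSpace d M μ) (⨆ ν, ⨆ _ : ν ≠ μ, weightSpace d M ν) := by
  refine ⟨iSupIndep_weightSpace d M μ, codisjoint_iff_le_sup.2 ?_⟩
  rw [← h, iSup_le_iff]
  intro k
  by_cases hk : lam + k = μ
  · exact le_sup_of_le_left (hk ▸ le_rfl)
  · exact le_sup_of_le_right (le_iSup₂_of_le (lam + k) hk le_rfl)

lemma mk_eulerZero : Ideal.Quotient.mk (eulerIdeal d lam) (eulerZero K d) =
    Ideal.Quotient.mk (eulerIdeal d lam) (algebraMap K _ lam) :=
  Ideal.Quotient.eq.2 (Ideal.subset_span rfl)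

variable {N : Type*} [AddCommGroup N] [Module (TwistedOps d lam) N]

lemma map_eq_zero_of_mem_weightSpace (f : M →ₛₗ[Ideal.Quotient.mk (eulerIdeal d lam)] N) {μ : K}
    (hμ : μ ≠ lam) {m : M} (hm : m ∈ weightSpace d M μ) : f m = 0 := by
  have hf : f (algebraMap K (weylZero K d) (μ - lam) • m) = 0 := by
    have hm' : eulerZero K d • m = algebraMap K (weylZero K d) μ • m := hm
    rw [map_sub, sub_smul, ← hm', map_sub, map_smulₛₗ, map_smulₛₗ, mk_eulerZero, sub_self]
  rw [map_smulₛₗ] at hf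
  exact (((isUnit_iff_ne_zero.2 (sub_ne_zero.2 hμ)).map _).map _).smul_eq_zero.1 hf

/-- Since `E` acts on `N` by `λ`, a `𝔻₀`-linear map from a `λ`-Euler module to `N` is determined by
its restriction to the weight `λ`, and that restriction is arbitrary. -/
def IsEulerModule.weightSpaceHomEquiv (h : IsEulerModule d M lam) :
    (weightSpace d M lam →ₗ[TwistedOps d lam] N) ≃
      (M →ₛₗ[Ideal.Quotient.mk (eulerIdeal d lam)] N) where
  toFun g :=
    { toFun m := g (Submodule.projectionOnto _ _ (h.isCompl_weightSpace lam) m)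
      map_add' a b := by rw [map_add, map_add]
      map_smul' a m := by rw [map_smul, ← twistedOps_mk_smul, map_smul] }
  invFun f :=
    { toFun m := f m
      map_add' a b := map_add f _ _
      map_smul' a m := by
        obtain ⟨a, rfl⟩ := Ideal.Quotient.mk_surjective a
        exact map_smulₛₗ f a (m : M) }
  left_inv g := LinearMap.ext fun m => congrArg g (Submodule.projectionOnto_apply_left _ m)
  right_inv f := by
    refine LinearMap.ext fun m => ?_
    have hker : ⨆ ν, ⨆ _ : ν ≠ lam, weightSpace d M ν ≤ LinearMap.ker f :=
      iSup₂_le fun ν hν m hm => map_eq_zero_of_mem_weightSpace f hν hm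
    have hm := LinearMap.mem_ker.1
      (hker (Submodule.sub_projection_mem (h.isCompl_weightSpace lam) m))
    rw [map_sub, sub_eq_zero] at hm
    exact hm.symm

end DegreeZero

section Semilinear

variable {K : Type u} [Field K] [CharZero K] {n : ℕ} {d : Fin (n + 1) → ℕ+} {lam : K}
  {N : Type*} [AddCommGroup N] [Module (TwistedOps d lam) N]

lemma map_eq_zero_of_mem_weylDegree {f : Weyl K n →ₛₗ[Ideal.Quotient.mk (eulerIdeal d lam)] N}
    (hf : ∀ v, f (v * euler K d) = f (v * algebraMap K _ lam)) {k : ℤ} (hk : k ≠ 0) {v : Weyl K n}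
    (hv : v ∈ weylDegree K d k) : f v = 0 := by
  have hadE : algebraMap K (weylZero K d) k • v = eulerZero K d • v - v * euler K d := by
    rw [eq_sub_iff_add_eq', algebraMap_smul]
    exact (euler_commute d hv).symm
  have hk' : f (algebraMap K (weylZero K d) k • v) = 0 := by
    rw [hadE, map_sub, hf, ← Algebra.commutes, map_smulₛₗ, mk_eulerZero, ← map_smulₛₗ]
    exact sub_self _
  rw [map_smulₛₗ] at hk'
  exact (((isUnit_iff_ne_zero.2 (Int.cast_ne_zero.2 hk)).map _).map _).smul_eq_zero.1 hk'

lemma map_eq_weylZeroProj_smul {f : Weyl K n →ₛₗ[Ideal.Quotient.mk (eulerIdeal d lam)] N}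
    (hf : ∀ v, f (v * euler K d) = f (v * algebraMap K _ lam)) (v : Weyl K n) :
    f v = Ideal.Quotient.mk (eulerIdeal d lam) (weylZeroProj K d v) • f 1 := by
  induction v using DirectSum.Decomposition.inductionOn (weylDegree K d) with
  | zero => rw [map_zero, map_zero, map_zero, zero_smul]
  | add v w hv hw => rw [map_add, map_add, map_add, add_smul, hv, hw]
  | @homogeneous k v =>
    obtain ⟨v, hv⟩ := v
    by_cases hk : k = 0
    · subst hk
      let a : weylZero K d := ⟨v, hv⟩
      calc f v = f (a • 1) := congrArg f (mul_one v).symm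
        _ = Ideal.Quotient.mk (eulerIdeal d lam) (weylZeroProj K d a) • f 1 := by
          rw [map_smulₛₗ, weylZeroProj_coe]
    · rw [map_eq_zero_of_mem_weylDegree hf hk hv, weylZeroProj_eq_zero d hk hv, map_zero,
        zero_smul]

lemma exists_map_one_eq (x : N) :
    ∃ f : Weyl K n →ₛₗ[Ideal.Quotient.mk (eulerIdeal d lam)] N,
      (∀ v, f (v * euler K d) = f (v * algebraMap K _ lam)) ∧ f 1 = x := by
  let f : Weyl K n →ₛₗ[Ideal.Quotient.mk (eulerIdeal d lam)] N :=
    { toFun v := Ideal.Quotient.mk (eulerIdeal d lam) (weylZeroProj K d v) • x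
      map_add' v w := by rw [map_add, map_add, add_smul]
      map_smul' a v := by rw [map_smul, smul_eq_mul, map_mul, mul_smul] }
  refine ⟨f, fun v => ?_, ?_⟩
  · calc f (v * euler K d)
        = Ideal.Quotient.mk (eulerIdeal d lam) (weylZeroProj K d v * eulerZero K d) • x :=
          congrArg (Ideal.Quotient.mk (eulerIdeal d lam) · • x)
            (weylZeroProj_mul_coe d v (eulerZero K d))
      _ = Ideal.Quotient.mk (eulerIdeal d lam)
            (weylZeroProj K d v * algebraMap K (weylZero K d) lam) • x := by
          rw [map_mul, map_mul, mk_eulerZero]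
      _ = f (v * algebraMap K _ lam) :=
          congrArg (Ideal.Quotient.mk (eulerIdeal d lam) · • x)
            (weylZeroProj_mul_coe d v (algebraMap K _ lam)).symm
  · change Ideal.Quotient.mk (eulerIdeal d lam) (weylZeroProj K d (1 : weylZero K d)) • x = x
    rw [weylZeroProj_coe, map_one, one_smul]

end Semilinear

section Coinduced

variable {K : Type u} [Field K] {n : ℕ} (d : Fin (n + 1) → ℕ+) (lam : K)
  (N : ModuleCat.{u} (TwistedOps d lam))

/-- The coinduced `𝔻`-module `Hom_{𝔻₀}(𝔻, N)` of a `𝔻₀ / 𝔻₀ (E - λ)`-module `N`; `𝔻` acts by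
right multiplication on the source. -/
abbrev coind : ModuleCat.{u} (Weyl K n) :=
  (ModuleCat.coextendScalars (weylZero K d).val.toRingHom).obj
    ((ModuleCat.restrictScalars (Ideal.Quotient.mk (eulerIdeal d lam))).obj N)

/-- The elements of the coinduced module as semilinear maps along `𝔻₀ → 𝔻₀ / 𝔻₀ (E - λ)`. -/
def coindEquiv : coind d lam N ≃ (Weyl K n →ₛₗ[Ideal.Quotient.mk (eulerIdeal d lam)] N) where
  toFun (f : _ →ₗ[weylZero K d] _) :=
    { toFun v := f v, map_add' := map_add f, map_smul' := map_smul f }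
  invFun f :=
    show _ →ₗ[weylZero K d] _ from
      { toFun v := f v, map_add' := map_add f, map_smul' := map_smulₛₗ f }

variable {d lam N}

lemma mem_weightSpace_coind {f : coind d lam N} {μ : K} :
    f ∈ weightSpace d (coind d lam N) μ ↔
      ∀ v, coindEquiv d lam N f (v * euler K d) = coindEquiv d lam N f (v * algebraMap K _ μ) :=
  DFunLike.ext_iff (F := _ →ₗ[weylZero K d] _)

variable [CharZero K]

lemma bijective_coindEquiv_apply_one :
    Function.Bijective fun f : weightSpace d (coind d lam N) lam => coindEquiv d lam N f 1 := by
  refine ⟨fun f g hfg => Subtype.ext ((coindEquiv d lam N).injective (LinearMap.ext fun v => ?_)),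
    fun x => ?_⟩
  · rw [map_eq_weylZeroProj_smul (mem_weightSpace_coind.1 f.2),
      map_eq_weylZeroProj_smul (mem_weightSpace_coind.1 g.2)]
    exact congrArg _ hfg
  · obtain ⟨f, hf, hx⟩ := exists_map_one_eq (d := d) (lam := lam) x
    exact ⟨⟨(coindEquiv d lam N).symm f, mem_weightSpace_coind.2 hf⟩, hx⟩

end Coinduced

section EulerPart

variable {K : Type u} [Field K] {n : ℕ} {d : Fin (n + 1) → ℕ+} {lam : K} {M N : Type*}
  [AddCommGroup M] [Module (Weyl K n) M] [AddCommGroup N] [Module (Weyl K n) N]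

lemma mem_eulerPart_of_mem_weightSpace {m : M} (hm : m ∈ weightSpace d M lam) :
    m ∈ eulerPart d M lam :=
  Submodule.mem_iSup_of_mem (p := fun k : ℤ => weightSpace d M (lam + k)) 0 (by simpa using hm)

variable [CharZero K]

lemma isEulerModule_eulerPart : IsEulerModule d (eulerPart d M lam) lam := by
  refine (isEulerModule_iff d).2 fun m => ?_
  obtain ⟨S, hS⟩ := (mem_eulerPart_iff d).1 m.2
  exact ⟨S, Subtype.ext hS⟩

lemma IsEulerModule.map_mem_eulerPart (h : IsEulerModule d M lam) (f : M →ₗ[Weyl K n] N) (m : M) :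
    f m ∈ eulerPart d N lam := by
  obtain ⟨S, hS⟩ := (isEulerModule_iff d).1 h m
  exact (mem_eulerPart_iff d).2 ⟨S, by rw [← map_smul, hS, map_zero]⟩

end EulerPart

section Adjunction

variable {K : Type u} [Field K] {n : ℕ} (d : Fin (n + 1) → ℕ+) (lam : K)

/-- The degree zero part of a `λ`-Euler module. -/
abbrev eulerDegreeZero : EulerMod d lam ⥤ ModuleCat.{u} (TwistedOps d lam) :=
  (isEuler d lam).ι ⋙ degreeZero d lam

variable {d lam} in
/-- A map of `𝔻`-modules from a `λ`-Euler module `M` to the coinduced module of `N` amounts to a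
map `M₀ → N`, obtained by evaluation at `1`. -/
def coindHomEquiv (M : EulerMod d lam) (N : ModuleCat.{u} (TwistedOps d lam)) :
    ((eulerDegreeZero d lam).obj M ⟶ N) ≃ ((isEuler d lam).ι.obj M ⟶ coind d lam N) :=
  ModuleCat.homEquiv.trans <|
    (M.property.weightSpaceHomEquiv (N := N)).trans <|
    (ModuleCat.semilinearMapAddEquiv _
      ((ModuleCat.restrictScalars (weylZero K d).val.toRingHom).obj M.obj) N).toEquiv.trans <|
    (ModuleCat.restrictCoextendScalarsAdj (weylZero K d).val.toRingHom).homEquiv _ _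

variable [CharZero K]

/-- The largest `λ`-Euler submodule of a `𝔻`-module, as an object of the category of `λ`-Euler
modules. -/
def eulerPartObj (N : ModuleCat.{u} (Weyl K n)) : EulerMod d lam :=
  ⟨ModuleCat.of (Weyl K n) (eulerPart d N lam), isEulerModule_eulerPart⟩

variable {d lam}

/-- The universal property of the Euler part. -/
def eulerPartHomEquiv (M : EulerMod d lam) (N : ModuleCat.{u} (Weyl K n)) :
    ((isEuler d lam).ι.obj M ⟶ N) ≃ (M ⟶ eulerPartObj d lam N) where
  toFun f := ObjectProperty.homMk
    (ModuleCat.ofHom (f.hom.codRestrict _ (M.property.map_mem_eulerPart f.hom)))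
  invFun g := ModuleCat.ofHom ((eulerPart d N lam).subtype ∘ₗ g.hom.hom)

variable (d lam)

/-- The bijection exhibiting the Euler part of the coinduced module as a right adjoint of the degree
zero part. -/
def degreeZeroHomEquiv (M : EulerMod d lam) (N : ModuleCat.{u} (TwistedOps d lam)) :
    ((eulerDegreeZero d lam).obj M ⟶ N) ≃ (M ⟶ eulerPartObj d lam (coind d lam N)) :=
  (coindHomEquiv M N).trans (eulerPartHomEquiv M _)

lemma degreeZeroHomEquiv_naturality {M' M : EulerMod d lam} {N : ModuleCat.{u} (TwistedOps d lam)}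
    (f : M' ⟶ M) (g : (eulerDegreeZero d lam).obj M ⟶ N) :
    degreeZeroHomEquiv d lam M' N ((eulerDegreeZero d lam).map f ≫ g) =
      f ≫ degreeZeroHomEquiv d lam M N g := by
  refine (Equiv.eq_symm_apply _).1 ?_
  obtain ⟨g, rfl⟩ := (degreeZeroHomEquiv d lam M N).symm.surjective g
  rw [Equiv.apply_symm_apply]
  rfl

/-- The functor sending a `𝔻₀ / 𝔻₀ (E - λ)`-module to the Euler part of its coinduced module. -/
def coinduction : ModuleCat.{u} (TwistedOps d lam) ⥤ EulerMod d lam :=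
  Adjunction.rightAdjointOfEquiv (degreeZeroHomEquiv d lam)
    fun _ _ _ => degreeZeroHomEquiv_naturality d lam

/-- Coinduction is right adjoint to the degree zero part. -/
def coinductionAdjunction : eulerDegreeZero d lam ⊣ coinduction d lam :=
  Adjunction.adjunctionOfEquivRight (degreeZeroHomEquiv d lam)
    fun _ _ _ => degreeZeroHomEquiv_naturality d lam

lemma coinductionAdjunction_counit_app_apply {N : ModuleCat.{u} (TwistedOps d lam)}
    (f : weightSpace d (eulerPart d (coind d lam N) lam) lam) :
    (coinductionAdjunction d lam).counit.app N f =
      coindEquiv d lam N (f : eulerPart d (coind d lam N) lam) 1 := by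
  rw [coinductionAdjunction, Adjunction.adjunctionOfEquivRight_counit_app]
  rfl

instance : IsIso (coinductionAdjunction d lam).counit := by
  have (N : ModuleCat.{u} (TwistedOps d lam)) :
      IsIso ((coinductionAdjunction d lam).counit.app N) := by
    rw [ConcreteCategory.isIso_iff_bijective]
    let e : weightSpace d (eulerPart d (coind d lam N) lam) lam ≃
        weightSpace d (coind d lam N) lam :=
      { toFun f := ⟨f.1, congrArg Subtype.val f.2⟩
        invFun f := ⟨⟨f, mem_eulerPart_of_mem_weightSpace f.2⟩, Subtype.ext f.2⟩ }
    have h := bijective_coindEquiv_apply_one.comp e.bijective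
    exact (congrArg _ (funext (coinductionAdjunction_counit_app_apply d lam))).mpr h
  exact NatIso.isIso_of_isIso_app _

end Adjunction

section DegreeZeroFunctor

variable {K : Type u} [Field K] {n : ℕ} {d : Fin (n + 1) → ℕ+} {lam : K}

lemma isTorsionEuler_le_kernel_eulerDegreeZero (hlam : lam ∉ torsionWeights K d) :
    isTorsionEuler d lam ≤ (eulerDegreeZero d lam).kernel := fun M hM => by
  refine ModuleCat.isZero_of_iff_subsingleton.2 (subsingleton_of_forall_eq 0 ?_)
  intro (m : weightSpace d M.obj lam)
  by_contra hm
  exact hlam ((hM (m : M.obj)).mem_torsionWeights m.2 fun h => hm (Subtype.ext h))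

variable (d lam)

instance : (eulerDegreeZero d lam).Additive where
  map_add := rfl

variable [CharZero K]

instance : (eulerDegreeZero d lam).PreservesMonomorphisms where
  preserves f _ := by
    have hf := (ModuleCat.mono_iff_injective ((isEuler d lam).ι.map f)).1 inferInstance
    exact (ModuleCat.mono_iff_injective _).2 fun a b hab =>
      Subtype.ext (hf (congrArg Subtype.val hab))

instance : PreservesFiniteColimits (eulerDegreeZero d lam) :=
  have := (coinductionAdjunction d lam).leftAdjoint_preservesColimits
  inferInstance

instance : PreservesFiniteLimits (eulerDegreeZero d lam) :=
  have := (eulerDegreeZero d lam).preservesHomology_of_preservesMonos_and_cokernels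
  (eulerDegreeZero d lam).preservesFiniteLimits_of_preservesHomology

instance : (eulerDegreeZero d lam).IsLocalization
    ((MorphismProperty.isomorphisms _).inverseImage (eulerDegreeZero d lam)) :=
  have := (coinductionAdjunction d lam).fullyFaithfulROfIsIsoCounit.full
  have := (coinductionAdjunction d lam).fullyFaithfulROfIsIsoCounit.faithful
  (coinductionAdjunction d lam).isLocalization

variable {d lam}

lemma isInvertedBy_eulerDegreeZero (hlam : lam ∉ torsionWeights K d) :
    (isTorsionEuler d lam).isoModSerre.IsInvertedBy (eulerDegreeZero d lam) :=
  (ObjectProperty.isoModSerre_isInvertedBy_iff _ _).2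
    (isTorsionEuler_le_kernel_eulerDegreeZero hlam)

end DegreeZeroFunctor

end WPS

end

theorem mainTheorem2 {K : Type u} [Field K] [CharZero K]
    (n : ℕ) (hn : 1 ≤ n) (d : Fin (n + 1) → ℕ+) (lam : K)
    (hlam : ∀ a ∈ AddSubmonoid.closure (Set.range fun i => ((d i : ℕ) : K)),
      lam ≠ -(∑ i, ((d i : ℕ) : K)) - a) :
    ∃ (_ : PreservesFiniteLimits (WPS.globalSections d lam))
      (_ : PreservesFiniteColimits (WPS.globalSections d lam))
      (F : (WPS.globalSections d lam).kernel.isoModSerre.Localization ⥤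
        ModuleCat.{u} (WPS.TwistedOps d lam)),
      Nonempty ((WPS.globalSections d lam).kernel.isoModSerre.Q ⋙ F ≅ WPS.globalSections d lam) ∧
        F.IsEquivalence := by
  have hinv := WPS.isInvertedBy_eulerDegreeZero (d := d) fun ⟨a, ha, h⟩ => hlam a ha h
  have adj := WPS.quotAdjunction d lam
  have hlim : PreservesFiniteLimits (WPS.globalSections d lam) :=
    WPS.preservesFiniteLimits_section_comp _ adj hinv
  have hcolim : PreservesFiniteColimits (WPS.globalSections d lam) :=
    WPS.preservesFiniteColimits_section_comp _ adj hinv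
  have hloc : (WPS.globalSections d lam).IsLocalization
      (WPS.globalSections d lam).kernel.isoModSerre := by
    rw [Abelian.isoModSerre_kernel_eq_inverseImage_isomorphisms]
    exact WPS.isLocalization_section_comp _ adj hinv
  exact ⟨hlim, hcolim, _,
    ⟨Localization.qCompEquivalenceFromModelFunctorIso (WPS.globalSections d lam) _⟩, inferInstance⟩
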